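/- Let $M$ be a smooth $n$-dimensional manifold with smooth Riemannian metric $g$, let $x_0\in M$, and let $(x^1,\dots,x^n)$ be a normal coordinate system centred at $x_0$: a smooth chart sending $x_0$ to $0$, whose coordinate frame $e_i=\partial_i|_{x_0}$ is orthonormal at $x_0$, and in which the straight rays $t\mapsto tv$ emanating from the origin are geodesics of $M$. Let $$\Gamma_{ij}^k=\tfrac12\sum_l g^{kl}\left(\partial_j g_{il}+\partial_i g_{jl}-\partial_l g_{ij}\right)$$ be the Christoffel symbols in these coordinates and $$R_{ijkl}=g\left(R(\partial_k,\partial_l)\partial_j,\partial_i\right),\qquad R(X,Y)=\nabla_X\nabla_Y-\nabla_Y\nabla_X-\nabla_{[X,Y]},$$ the components of the Riemann curvature tensor, where $\nabla$ is the Levi-Civita connection. Let $C(T_{x_0}M)$ be the Clifford algebra generated by $T_{x_0}M$ with the relations $c(v)^2=-g(v,v)$, put $\gamma_i=c(e_i)$ and $$\sigma_{ij}=\tfrac18[\gamma_i,\gamma_j]=\tfrac18(\gamma_i\gamma_j-\gamma_j\gamma_i),$$ viewed in $C(T_{x_0}M)$ or, more generally, in any real associative unital algebra on which $C(T_{x_0}M)$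 is represented (for instance $\mathrm{End}(S)$ for a Clifford module $S$ such as the spinors). Then, at the centre $x_0$, for all indices $a,i$, $$\sum_{j,k}\partial_a\Gamma_{ij}^k\,\sigma_{kj}=\frac12\sum_{j,k}R_{jkia}\,\sigma_{kj}.$$ In particular $\sum_{j,k}\partial_i\Gamma_{ij}^k\,\sigma_{kj}=0$ for every $i$, and hence also $\sum_{i,j,k}\partial_i\Gamma_{ij}^k\,\sigma_{kj}=0$. -/

import Mathlib

open scoped Manifold ContDiff Bundle

noncomputable section

namespace NormalCoord

/-- Model space `ℝⁿ`. -/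
abbrev Model (n : ℕ) : Type := EuclideanSpace ℝ (Fin n)

/-- Smooth Riemannian metrics on the `n`-dimensional manifold `M`. -/
abbrev RMetric (n : ℕ) (M : Type*) [TopologicalSpace M] [ChartedSpace (Model n) M]
    [IsManifold 𝓘(ℝ, Model n) ∞ M] :=
  Bundle.ContMDiffRiemannianMetric 𝓘(ℝ, Model n) ∞ (Model n)
    (fun x : M => TangentSpace 𝓘(ℝ, Model n) x)

/-- The partial derivative `∂ₐ f` at the point `x ∈ ℝⁿ`. -/
def pd {n : ℕ} (a : Fin n) (f : Model n → ℝ) (x : Model n) : ℝ :=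
  fderiv ℝ f x (EuclideanSpace.single a 1)

section Manifold

variable {n : ℕ} {M : Type*} [TopologicalSpace M] [ChartedSpace (Model n) M]

/-- The coordinate vector `∂ᵢ` of the chart `φ`, at the point with coordinates `x`. -/
def coordVec (φ : OpenPartialHomeomorph M (Model n)) (i : Fin n) (x : Model n) :
    TangentSpace 𝓘(ℝ, Model n) (φ.symm x) :=
  mfderiv 𝓘(ℝ, Model n) 𝓘(ℝ, Model n) φ.symm x (EuclideanSpace.single i (1 : ℝ))

variable [IsManifold 𝓘(ℝ, Model n) ∞ M]

/-- The matrix `gᵢⱼ(x) = g(∂ᵢ, ∂ⱼ)` of the metric in the chart `φ`. -/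
def metricMatrix (g : RMetric n M) (φ : OpenPartialHomeomorph M (Model n)) (x : Model n) :
    Matrix (Fin n) (Fin n) ℝ :=
  Matrix.of fun i j => g.inner (φ.symm x) (coordVec φ i x) (coordVec φ j x)

/-- The Christoffel symbols of the Levi-Civita connection in the chart `φ`:
`Γ_{ij}^k = ½ ∑ₗ g^{kl} (∂ⱼ g_{il} + ∂ᵢ g_{jl} - ∂ₗ g_{ij})`. -/
def christoffel (g : RMetric n M) (φ : OpenPartialHomeomorph M (Model n))
    (i j k : Fin n) (x : Model n) : ℝ :=
  (1 / 2) * ∑ l, (metricMatrix g φ x)⁻¹ k l *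
    (pd j (fun y => metricMatrix g φ y i l) x + pd i (fun y => metricMatrix g φ y j l) x
      - pd l (fun y => metricMatrix g φ y i j) x)

/-- The components `R^m_{jkl}` of the curvature tensor in the chart `φ`:
`R(∂ₖ, ∂ₗ) ∂ⱼ = ∑ₘ R^m_{jkl} ∂ₘ`, where `R(X, Y) = ∇_X ∇_Y - ∇_Y ∇_X - ∇_{[X, Y]}`. -/
def curvatureUp (g : RMetric n M) (φ : OpenPartialHomeomorph M (Model n))
    (m j k l : Fin n) (x : Model n) : ℝ :=
  pd k (christoffel g φ l j m) x - pd l (christoffel g φ k j m) x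
    + ∑ r, (christoffel g φ k r m x * christoffel g φ l j r x
      - christoffel g φ l r m x * christoffel g φ k j r x)

/-- The components `R_{ijkl} = g(R(∂ₖ, ∂ₗ) ∂ⱼ, ∂ᵢ)` of the curvature tensor in the chart `φ`.
With this sign `R_{1212}` is positive on round spheres, and
`g_{ij} = δ_{ij} - ⅓ ∑_{k,l} R_{ikjl} xᵏ xˡ + O(|x|³)` in normal coordinates. -/
def curvature (g : RMetric n M) (φ : OpenPartialHomeomorph M (Model n))
    (i j k l : Fin n) (x : Model n) : ℝ :=
  ∑ m, metricMatrix g φ x i m * curvatureUp g φ m j k l x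

/-- `c` is a geodesic of `g` on the open set `s` of times: it is smooth there, and in every
smooth chart it solves `(cᵏ)'' + ∑ᵢⱼ Γ_{ij}^k (cⁱ)' (cʲ)' = 0`. -/
def IsGeodesicOn (g : RMetric n M) (c : ℝ → M) (s : Set ℝ) : Prop :=
  ContMDiffOn 𝓘(ℝ, ℝ) 𝓘(ℝ, Model n) ∞ c s ∧
    ∀ ψ ∈ IsManifold.maximalAtlas 𝓘(ℝ, Model n) ∞ M, ∀ t ∈ s, c t ∈ ψ.source → ∀ k : Fin n,
      deriv (deriv fun r => ψ (c r) k) t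
        + ∑ i, ∑ j, christoffel g ψ i j k (ψ (c t))
          * deriv (fun r => ψ (c r) i) t * deriv (fun r => ψ (c r) j) t = 0

/-- `φ` is a (Riemannian) normal coordinate system centred at `x₀`: a smooth chart with
`φ x₀ = 0` whose coordinate frame is orthonormal at `x₀`, and for which the straight rays
`t ↦ t v` emanating from the origin correspond to geodesics of `M` emanating from `x₀`.
Equivalently, `φ⁻¹` is the exponential map at `x₀` composed with an isometry `ℝⁿ ≃ T_{x₀} M`. -/
structure IsNormalChart (g : RMetric n M) (x₀ : M)
    (φ : OpenPartialHomeomorph M (Model n)) : Prop where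
  mem_atlas : φ ∈ IsManifold.maximalAtlas 𝓘(ℝ, Model n) ∞ M
  mem_source : x₀ ∈ φ.source
  map_center : φ x₀ = 0
  orthonormal : metricMatrix g φ 0 = 1
  geodesic_ray : ∀ v : Model n,
    IsGeodesicOn g (fun t : ℝ => φ.symm (t • v)) {t : ℝ | t • v ∈ φ.target}

/-- The quadratic form `v ↦ -g(v, v)` on the tangent space at `x`: Clifford multiplication
satisfies `c(v)² = -g(v, v)`. -/
def cliffordForm (g : RMetric n M) (x : M) : QuadraticForm ℝ (TangentSpace 𝓘(ℝ, Model n) x) :=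
  LinearMap.BilinMap.toQuadraticMap (-(g.inner x).toLinearMap₁₂)

/-- The Clifford algebra `C(T_x M)` of the tangent space at `x`. -/
abbrev Clifford (g : RMetric n M) (x : M) : Type :=
  CliffordAlgebra (cliffordForm g x)

/-- The generator `γᵢ = c(eᵢ)`, for the frame `eᵢ = ∂ᵢ` at the centre of the chart `φ`. -/
def gammaGen (g : RMetric n M) (φ : OpenPartialHomeomorph M (Model n)) (i : Fin n) :
    Clifford g (φ.symm 0) :=
  CliffordAlgebra.ι (cliffordForm g (φ.symm 0)) (coordVec φ i 0)

/-- `σᵢⱼ = ⅛ [γᵢ, γⱼ]` in the Clifford algebra of the tangent space at the centre. -/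
def sigma (g : RMetric n M) (φ : OpenPartialHomeomorph M (Model n)) (i j : Fin n) :
    Clifford g (φ.symm 0) :=
  (1 / 8 : ℝ) • (gammaGen g φ i * gammaGen g φ j - gammaGen g φ j * gammaGen g φ i)

end Manifold

end NormalCoord

end

open scoped Manifold ContDiff Bundle

namespace NormalCoord

section Calculus

variable {n : ℕ}

/-! Straight rays are geodesics, so `Γ(tv)(v, v) = 0`. At `t = 0` polarization gives `Γ = 0` at the
centre; the `t`-derivative there gives the cyclic identity `pd_christoffel_cyclic` for `∂Γ`. Hence
at the centre the curvature is a difference of two `∂Γ`, and `∂Γ` is linear in the second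
derivatives `∂ₐ∂_b g_{ij}`. The cyclic identity makes these invariant under `(a b) ↔ (i j)`
(`pair_symm_of_cyclic`), so `∂ₐΓ_{ij}^k + ∂ᵢΓ_{aj}^k` is symmetric in `j, k`. Then the coefficients
of the two sides differ by something symmetric in `j, k`, which the antisymmetric `σ` annihilates.
-/

theorem pd_comm {f : Model n → ℝ} {x : Model n} (hf : ContDiffAt ℝ 2 f x) (a b : Fin n) :
    pd a (fun y => pd b f y) x = pd b (fun y => pd a f y) x := by
  have hd : DifferentiableAt ℝ (fderiv ℝ f) x :=
    (hf.fderiv_right (m := 1) (by norm_num)).differentiableAt (by norm_num)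
  have hs := hf.isSymmSndFDerivAt (by simp)
  have key : ∀ c d : Fin n, pd c (fun y => pd d f y) x
      = fderiv ℝ (fderiv ℝ f) x (EuclideanSpace.single c 1) (EuclideanSpace.single d 1) := by
    intro c d
    simp only [pd]
    rw [fderiv_clm_apply hd (differentiableAt_const _)]
    simp
  rw [key, key, hs.eq]

theorem differentiableAt_pd {f : Model n → ℝ} {x : Model n} (hf : ContDiffAt ℝ 2 f x)
    (a : Fin n) : DifferentiableAt ℝ (pd a f) x :=
  ((hf.fderiv_right (m := 1) (by norm_num)).differentiableAt (by norm_num)).clm_apply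
    (differentiableAt_const _)

theorem fderiv_eq_sum_pd (f : Model n → ℝ) (x v : Model n) :
    fderiv ℝ f x v = ∑ a, v a * pd a f x := by
  have hv : v = ∑ a, v a • EuclideanSpace.single a (1 : ℝ) := by
    ext i
    simp [Pi.single_apply]
  conv_lhs => rw [hv]
  simp [pd]

theorem differentiableAt_det {m : ℕ} {G : Model n → Matrix (Fin m) (Fin m) ℝ} {x : Model n}
    (hG : ∀ i j, DifferentiableAt ℝ (fun y => G y i j) x) :
    DifferentiableAt ℝ (fun y => (G y).det) x := by
  simp only [Matrix.det_apply]
  fun_prop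

theorem differentiableAt_inv_apply {m : ℕ} {G : Model n → Matrix (Fin m) (Fin m) ℝ} {x : Model n}
    (hG : ∀ i j, DifferentiableAt ℝ (fun y => G y i j) x) (hx : (G x).det ≠ 0) (i j : Fin m) :
    DifferentiableAt ℝ (fun y => (G y)⁻¹ i j) x := by
  simp only [Matrix.inv_def, Ring.inverse_eq_inv', Matrix.smul_apply, smul_eq_mul,
    Matrix.adjugate_apply]
  refine ((differentiableAt_det hG).inv hx).mul (differentiableAt_det fun k l => ?_)
  by_cases h : k = j
  · subst h; simp
  · simpa [Matrix.updateRow_ne h] using hG k l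

end Calculus

/-! ### Smoothness and symmetry of the metric coefficients -/

section Manifold

variable {n : ℕ} {M : Type*} [TopologicalSpace M] [ChartedSpace (Model n) M]
  [IsManifold 𝓘(ℝ, Model n) ∞ M] {φ : OpenPartialHomeomorph M (Model n)}

/-- The frame field is the tangent map of `φ.symm` composed with a constant section of `Tℝⁿ`. -/
theorem contMDiffOn_coordVec (hφ : φ ∈ IsManifold.maximalAtlas 𝓘(ℝ, Model n) ∞ M) (i : Fin n) :
    ContMDiffOn 𝓘(ℝ, Model n) 𝓘(ℝ, Model n).tangent ∞
      (fun x => (Bundle.TotalSpace.mk' (Model n) (φ.symm x) (coordVec φ i x) :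
        TangentBundle 𝓘(ℝ, Model n) M)) φ.target := by
  have : IsManifold 𝓘(ℝ, Model n) 1 M := .of_le (n := ∞) (by simp)
  have h1 := (contMDiffOn_symm_of_mem_maximalAtlas hφ).contMDiffOn_tangentMapWithin
    (m := ∞) (by simp) φ.open_target.uniqueMDiffOn
  have h2 : ContMDiffOn 𝓘(ℝ, Model n) 𝓘(ℝ, Model n).tangent ∞
      (fun x => (⟨x, EuclideanSpace.single i (1 : ℝ)⟩ :
        TangentBundle 𝓘(ℝ, Model n) (Model n))) φ.target :=
    contMDiffOn_vectorSpace_iff_contDiffOn.2 contDiffOn_const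
  refine (h1.comp h2 fun x hx => hx).congr fun x hx => ?_
  simp only [Function.comp, tangentMapWithin, coordVec,
    mfderivWithin_of_isOpen φ.open_target hx]

theorem contDiffOn_metricMatrix (g : RMetric n M)
    (hφ : φ ∈ IsManifold.maximalAtlas 𝓘(ℝ, Model n) ∞ M) (i j : Fin n) :
    ContDiffOn ℝ ∞ (fun x => metricMatrix g φ x i j) φ.target := by
  rw [← contMDiffOn_iff_contDiffOn]
  intro x hx
  have hg := (g.contMDiff.contMDiffAt (x := φ.symm x)).comp_contMDiffWithinAt x
    (contMDiffOn_symm_of_mem_maximalAtlas hφ x hx)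
  have h := ContMDiffWithinAt.clm_bundle_apply₂ (F₃ := ℝ) (E₃ := fun _ : M => ℝ) hg
    (contMDiffOn_coordVec hφ i x hx) (contMDiffOn_coordVec hφ j x hx)
  rw [Bundle.contMDiffWithinAt_totalSpace] at h
  exact h.2

theorem metricMatrix_symm (g : RMetric n M) (i j : Fin n) (x : Model n) :
    metricMatrix g φ x i j = metricMatrix g φ x j i :=
  g.symm _ _ _

theorem christoffel_symm (g : RMetric n M) (i j k : Fin n) (x : Model n) :
    christoffel g φ i j k x = christoffel g φ j i k x := by
  simp only [christoffel, metricMatrix_symm g j i]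
  congr 1
  exact Finset.sum_congr rfl fun l _ => by ring

end Manifold

/-! ### Polarization and index symmetries -/

section Algebra

variable {m : ℕ}

theorem eq_zero_of_quadratic_vanish {D : Fin m → Fin m → ℝ} (hs : ∀ i j, D i j = D j i)
    (h : ∀ v : Fin m → ℝ, ∑ i, ∑ j, D i j * v i * v j = 0) (i j : Fin m) : D i j = 0 := by
  let B (u v : Fin m → ℝ) : ℝ := ∑ i, ∑ j, D i j * u i * v j
  have hl : ∀ u u' v, B (u + u') v = B u v + B u' v := fun u u' v => by
    simp only [B, Pi.add_apply, mul_add, add_mul, Finset.sum_add_distrib]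
  have hr : ∀ u v v', B u (v + v') = B u v + B u v' := fun u v v' => by
    simp only [B, Pi.add_apply, mul_add, Finset.sum_add_distrib]
  have he : ∀ i j, B (Pi.single i 1) (Pi.single j 1) = D i j := fun i j => by
    simp [B, Pi.single_apply]
  have h0 : ∀ v, B v v = 0 := h
  have h1 := h0 (Pi.single i 1 + Pi.single j 1)
  simp only [hl, hr, h0, he] at h1
  linarith [hs i j]

/-- Polarization of a cubic form: its values on sums of up to three basis vectors determine the
symmetrized coefficients. -/
theorem symmetrization_eq_zero_of_cubic_vanish {D : Fin m → Fin m → Fin m → ℝ}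
    (hs : ∀ a i j, D a i j = D a j i)
    (h : ∀ v : Fin m → ℝ, ∑ i, ∑ j, (∑ a, v a * D a i j) * v i * v j = 0) (a i j : Fin m) :
    D a i j + D i j a + D j a i = 0 := by
  let B (u v w : Fin m → ℝ) : ℝ := ∑ i, ∑ j, (∑ a, u a * D a i j) * v i * w j
  have h₁ : ∀ u u' v w, B (u + u') v w = B u v w + B u' v w := fun u u' v w => by
    simp only [B, Pi.add_apply, add_mul, Finset.sum_add_distrib]
  have h₂ : ∀ u v v' w, B u (v + v') w = B u v w + B u v' w := fun u v v' w => by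
    simp only [B, Pi.add_apply, mul_add, add_mul, Finset.sum_add_distrib]
  have h₃ : ∀ u v w w', B u v (w + w') = B u v w + B u v w' := fun u v w w' => by
    simp only [B, Pi.add_apply, mul_add, Finset.sum_add_distrib]
  have he : ∀ a i j, B (Pi.single a 1) (Pi.single i 1) (Pi.single j 1) = D a i j :=
    fun a i j => by simp [B, Pi.single_apply]
  have h0 : ∀ v, B v v v = 0 := h
  have e₁ := h0 (Pi.single a 1)
  have e₂ := h0 (Pi.single i 1)
  have e₃ := h0 (Pi.single j 1)
  have e₁₂ := h0 (Pi.single a 1 + Pi.single i 1)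
  have e₁₃ := h0 (Pi.single a 1 + Pi.single j 1)
  have e₂₃ := h0 (Pi.single i 1 + Pi.single j 1)
  have e := h0 (Pi.single a 1 + Pi.single i 1 + Pi.single j 1)
  simp only [h₁, h₂, h₃, he] at e₁ e₂ e₃ e₁₂ e₁₃ e₂₃ e
  linarith [hs a i j, hs i a j, hs j a i]

/-- `G a b i j` stands for the second derivative `∂ₐ ∂_b g_{ij}` at the centre. -/
theorem pair_symm_of_cyclic {G : Fin m → Fin m → Fin m → Fin m → ℝ}
    (h₁ : ∀ a b i j, G a b i j = G b a i j) (h₂ : ∀ a b i j, G a b i j = G a b j i)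
    (hc : ∀ a i j k, (G a j i k + G a i j k - G a k i j) + (G i a j k + G i j a k - G i k j a)
      + (G j i a k + G j a i k - G j k a i) = 0) (a b i j : Fin m) :
    G a b i j = G i j a b := by
  -- The last index of `hc` is distinguished; each of the four takes that role once. In normalized
  -- form, `e₁ + e₂ - e₃ - e₄` cancels the other two pairings and leaves a multiple of the claim.
  have e₁ := hc a b i j
  have e₂ := hc a b j i
  have e₃ := hc a i j b
  have e₄ := hc b i j a
  simp only [h₁ b a, h₁ i a, h₁ j a, h₁ i b, h₁ j b, h₁ j i, h₂ _ _ b a, h₂ _ _ i a, h₂ _ _ j a,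
    h₂ _ _ i b, h₂ _ _ j b, h₂ _ _ j i] at e₁ e₂ e₃ e₄
  linarith

theorem sum_smul_eq_zero_of_symm {A : Type*} [AddCommGroup A] [Module ℝ A] {c : Fin m → Fin m → ℝ}
    {s : Fin m → Fin m → A} (hc : ∀ j k, c j k = c k j) (hs : ∀ j k, s j k = -s k j) :
    ∑ j, ∑ k, c j k • s k j = 0 := by
  have h : ∑ j, ∑ k, c j k • s k j = -∑ j, ∑ k, c j k • s k j := by
    conv_lhs => rw [Finset.sum_comm]
    simp only [← Finset.sum_neg_distrib]
    refine Finset.sum_congr rfl fun j _ => Finset.sum_congr rfl fun k _ => ?_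
    rw [hc k j, hs j k, smul_neg]
  rwa [eq_neg_iff_add_eq_zero, ← two_smul ℝ, smul_eq_zero_iff_right two_ne_zero] at h

end Algebra

/-! ### Consequences of the geodesic equation at the centre -/

section Normal

variable {n : ℕ} {M : Type*} [TopologicalSpace M] [ChartedSpace (Model n) M]
  [IsManifold 𝓘(ℝ, Model n) ∞ M] {φ : OpenPartialHomeomorph M (Model n)}
  {g : RMetric n M} {x₀ : M}

theorem IsNormalChart.zero_mem_target (hφ : IsNormalChart g x₀ φ) : (0 : Model n) ∈ φ.target :=
  hφ.map_center ▸ φ.map_source hφ.mem_source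

theorem IsNormalChart.contDiffAt_metricMatrix (hφ : IsNormalChart g x₀ φ) (i j : Fin n) :
    ContDiffAt ℝ 2 (fun x => metricMatrix g φ x i j) 0 :=
  ((contDiffOn_metricMatrix g hφ.mem_atlas i j).contDiffAt
    (φ.open_target.mem_nhds hφ.zero_mem_target)).of_le (WithTop.coe_le_coe.2 (le_top : (2 : ℕ∞) ≤ ⊤))

theorem IsNormalChart.differentiableAt_inv_metricMatrix (hφ : IsNormalChart g x₀ φ)
    (k l : Fin n) : DifferentiableAt ℝ (fun x => (metricMatrix g φ x)⁻¹ k l) 0 :=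
  differentiableAt_inv_apply
    (fun i j => (hφ.contDiffAt_metricMatrix i j).differentiableAt (by norm_num))
    (by simp [hφ.orthonormal]) k l

theorem IsNormalChart.differentiableAt_pd_metricMatrix (hφ : IsNormalChart g x₀ φ)
    (a i j : Fin n) : DifferentiableAt ℝ (fun x => pd a (fun y => metricMatrix g φ y i j) x) 0 :=
  differentiableAt_pd (hφ.contDiffAt_metricMatrix i j) a

theorem IsNormalChart.differentiableAt_christoffel (hφ : IsNormalChart g x₀ φ) (i j k : Fin n) :
    DifferentiableAt ℝ (christoffel g φ i j k) 0 := by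
  have hd := hφ.differentiableAt_pd_metricMatrix
  exact (DifferentiableAt.fun_sum fun l _ => (hφ.differentiableAt_inv_metricMatrix k l).mul
    (((hd j i l).add (hd i j l)).sub (hd l i j))).const_mul (1 / 2)

/-- The geodesic equation for the rays. -/
theorem IsNormalChart.christoffel_ray (hφ : IsNormalChart g x₀ φ) (v : Model n) {t : ℝ}
    (ht : t • v ∈ φ.target) (k : Fin n) :
    ∑ i, ∑ j, christoffel g φ i j k (t • v) * v i * v j = 0 := by
  have h := (hφ.geodesic_ray v).2 φ hφ.mem_atlas t ht (φ.map_target ht) k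
  have hopen : IsOpen {r : ℝ | r • v ∈ φ.target} :=
    φ.open_target.preimage (continuous_id.smul continuous_const)
  have hev : ∀ i, ∀ r ∈ {r : ℝ | r • v ∈ φ.target},
      deriv (fun r => φ (φ.symm (r • v)) i) r = v i := by
    intro i r hr
    have heq : (fun r => φ (φ.symm (r • v)) i) =ᶠ[nhds r] fun r => r * v i := by
      filter_upwards [hopen.mem_nhds hr] with s hs
      rw [φ.right_inv hs, PiLp.smul_apply, smul_eq_mul]
    rw [heq.deriv_eq]
    simp
  have h2 : deriv (deriv fun r => φ (φ.symm (r • v)) k) t = 0 := by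
    have heq : (deriv fun r => φ (φ.symm (r • v)) k) =ᶠ[nhds t] fun _ => v k := by
      filter_upwards [hopen.mem_nhds ht] with s hs using hev k s hs
    rw [heq.deriv_eq, deriv_const]
  simpa only [h2, zero_add, φ.right_inv ht, hev _ t ht] using h

theorem IsNormalChart.christoffel_zero (hφ : IsNormalChart g x₀ φ) (i j k : Fin n) :
    christoffel g φ i j k 0 = 0 := by
  refine eq_zero_of_quadratic_vanish (D := fun i j => christoffel g φ i j k 0)
    (fun i j => christoffel_symm g i j k 0) (fun v => ?_) i j
  simpa using hφ.christoffel_ray (WithLp.toLp 2 v) (t := 0) (by simpa using hφ.zero_mem_target) k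

theorem IsNormalChart.pd_christoffel_cyclic (hφ : IsNormalChart g x₀ φ) (a i j k : Fin n) :
    pd a (christoffel g φ i j k) 0 + pd i (christoffel g φ j a k) 0
      + pd j (christoffel g φ a i k) 0 = 0 := by
  refine symmetrization_eq_zero_of_cubic_vanish
    (D := fun a i j => pd a (christoffel g φ i j k) 0)
    (fun a i j => by rw [show christoffel g φ i j k = christoffel g φ j i k from
      funext (christoffel_symm g i j k)]) (fun w => ?_) a i j
  let v : Model n := WithLp.toLp 2 w
  have hray : HasDerivAt (fun t : ℝ => t • v) v 0 := by
    simpa using (hasDerivAt_id (0 : ℝ)).smul_const v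
  have hΓ : ∀ i j, HasDerivAt (fun t : ℝ => christoffel g φ i j k (t • v))
      (∑ a, w a * pd a (christoffel g φ i j k) 0) 0 := by
    intro i j
    have hd := (hφ.differentiableAt_christoffel i j k).hasFDerivAt
    -- The chain rule needs the base point in the form `0 • v`.
    rw [← zero_smul ℝ v] at hd
    have := hd.comp_hasDerivAt (0 : ℝ) hray
    rwa [zero_smul, fderiv_eq_sum_pd] at this
  have hsum : HasDerivAt (fun t : ℝ => ∑ i, ∑ j, christoffel g φ i j k (t • v) * w i * w j)
      (∑ i, ∑ j, (∑ a, w a * pd a (christoffel g φ i j k) 0) * w i * w j) 0 :=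
    .fun_sum fun i _ => .fun_sum fun j _ => ((hΓ i j).mul_const _).mul_const _
  have hev : (fun t : ℝ => ∑ i, ∑ j, christoffel g φ i j k (t • v) * w i * w j)
      =ᶠ[nhds 0] fun _ => 0 := by
    have hmem : {t : ℝ | t • v ∈ φ.target} ∈ nhds 0 :=
      (φ.open_target.preimage (continuous_id.smul continuous_const)).mem_nhds
        (by simpa using hφ.zero_mem_target)
    filter_upwards [hmem] with t ht using hφ.christoffel_ray v ht k
  exact hsum.unique ((hasDerivAt_const _ _).congr_of_eventuallyEq hev)

theorem IsNormalChart.christoffel_bracket_zero (hφ : IsNormalChart g x₀ φ) (i j l : Fin n) :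
    pd j (fun y => metricMatrix g φ y i l) 0 + pd i (fun y => metricMatrix g φ y j l) 0
      - pd l (fun y => metricMatrix g φ y i j) 0 = 0 := by
  have h := hφ.christoffel_zero i j l
  simp only [christoffel, hφ.orthonormal, inv_one, Matrix.one_apply] at h
  simpa using h

/-- In the product rule the derivative of the inverse metric multiplies a bracket that vanishes at
the centre, where the inverse metric itself is the identity. -/
theorem IsNormalChart.pd_christoffel (hφ : IsNormalChart g x₀ φ) (a i j k : Fin n) :
    pd a (christoffel g φ i j k) 0
      = (1 / 2) * (pd a (pd j fun y => metricMatrix g φ y i k) 0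
        + pd a (pd i fun y => metricMatrix g φ y j k) 0
        - pd a (pd k fun y => metricMatrix g φ y i j) 0) := by
  have hd := hφ.differentiableAt_pd_metricMatrix
  have hb : ∀ l, HasFDerivAt (fun x => pd j (fun y => metricMatrix g φ y i l) x
      + pd i (fun y => metricMatrix g φ y j l) x - pd l (fun y => metricMatrix g φ y i j) x)
      (fderiv ℝ (pd j fun y => metricMatrix g φ y i l) 0
        + fderiv ℝ (pd i fun y => metricMatrix g φ y j l) 0
        - fderiv ℝ (pd l fun y => metricMatrix g φ y i j) 0) 0 := fun l =>
    ((hd j i l).hasFDerivAt.add (hd i j l).hasFDerivAt).sub (hd l i j).hasFDerivAt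
  have h : HasFDerivAt (christoffel g φ i j k) _ 0 :=
    (HasFDerivAt.fun_sum (u := Finset.univ) fun l _ =>
      (hφ.differentiableAt_inv_metricMatrix k l).hasFDerivAt.mul (hb l)).const_mul (1 / 2)
  rw [pd, h.fderiv]
  simp only [hφ.christoffel_bracket_zero, hφ.orthonormal, inv_one, Matrix.one_apply]
  simp [pd]

theorem IsNormalChart.pd_pd_metricMatrix_pair_symm (hφ : IsNormalChart g x₀ φ)
    (a b i j : Fin n) :
    pd a (pd b fun y => metricMatrix g φ y i j) 0
      = pd i (pd j fun y => metricMatrix g φ y a b) 0 := by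
  refine pair_symm_of_cyclic (G := fun a b i j => pd a (pd b fun y => metricMatrix g φ y i j) 0)
    (fun a b i j => pd_comm (hφ.contDiffAt_metricMatrix i j) a b)
    (fun a b i j => by simp only [metricMatrix_symm g i j]) (fun a i j k => ?_) a b i j
  have h := hφ.pd_christoffel_cyclic a i j k
  simp only [hφ.pd_christoffel] at h
  linarith

/-- At the centre, `∂ₐ Γ_{ij}^k + ∂ᵢ Γ_{aj}^k` is symmetric in `j` and `k`. -/
theorem IsNormalChart.pd_christoffel_add_symm (hφ : IsNormalChart g x₀ φ) (a i j k : Fin n) :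
    pd a (christoffel g φ i j k) 0 + pd i (christoffel g φ a j k) 0
      = pd a (christoffel g φ i k j) 0 + pd i (christoffel g φ a k j) 0 := by
  -- Pair symmetry cancels the mixed terms, leaving only `∂ₐ∂ᵢ g_{jk}` and `∂ᵢ∂ₐ g_{jk}`.
  simp only [hφ.pd_christoffel, hφ.pd_pd_metricMatrix_pair_symm i k a j,
    hφ.pd_pd_metricMatrix_pair_symm i j a k, metricMatrix_symm g j k]
  ring

theorem IsNormalChart.curvature_zero (hφ : IsNormalChart g x₀ φ) (i j k l : Fin n) :
    curvature g φ i j k l 0 = pd k (christoffel g φ l j i) 0 - pd l (christoffel g φ k j i) 0 := by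
  simp [curvature, curvatureUp, hφ.orthonormal, hφ.christoffel_zero, Matrix.one_apply]

theorem sigma_antisymm (g : RMetric n M) (φ : OpenPartialHomeomorph M (Model n)) (i j : Fin n) :
    sigma g φ i j = -sigma g φ j i := by
  rw [sigma, sigma, ← smul_neg, neg_sub]

theorem IsNormalChart.sum_pd_christoffel_smul_sigma (hφ : IsNormalChart g x₀ φ)
    {A : Type*} [Ring A] [Algebra ℝ A] (ρ : Clifford g (φ.symm 0) →ₐ[ℝ] A) (a i : Fin n) :
    ∑ j, ∑ k, pd a (christoffel g φ i j k) 0 • ρ (sigma g φ k j)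
      = (1 / 2 : ℝ) • ∑ j, ∑ k, curvature g φ j k i a 0 • ρ (sigma g φ k j) := by
  have hs : ∀ j k, ρ (sigma g φ j k) = -ρ (sigma g φ k j) := fun j k => by
    rw [sigma_antisymm, map_neg]
  rw [← sub_eq_zero, Finset.smul_sum, ← Finset.sum_sub_distrib]
  simp only [Finset.smul_sum, ← Finset.sum_sub_distrib, smul_smul, ← sub_smul]
  refine sum_smul_eq_zero_of_symm (s := fun j k => ρ (sigma g φ j k)) (fun j k => ?_) hs
  -- Symmetry of `∂ₐΓ_{ij}^k - ½ R_{jkia}` in `j, k` is half of `pd_christoffel_add_symm`.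
  rw [hφ.curvature_zero, hφ.curvature_zero]
  linarith [hφ.pd_christoffel_add_symm a i j k]

theorem curvature_self (g : RMetric n M) (φ : OpenPartialHomeomorph M (Model n))
    (i j k : Fin n) (x : Model n) : curvature g φ i j k k x = 0 := by
  simp [curvature, curvatureUp]

end Normal

end NormalCoord

open NormalCoord in
theorem mainTheorem10 {n : ℕ} {M : Type*} [TopologicalSpace M] [ChartedSpace (Model n) M]
    [IsManifold 𝓘(ℝ, Model n) ∞ M] (g : RMetric n M) (x₀ : M)
    (φ : OpenPartialHomeomorph M (Model n)) (hφ : IsNormalChart g x₀ φ)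
    {A : Type*} [Ring A] [Algebra ℝ A] (ρ : Clifford g (φ.symm 0) →ₐ[ℝ] A) :
    (∀ a i : Fin n,
      ∑ j, ∑ k, pd a (christoffel g φ i j k) 0 • ρ (sigma g φ k j)
        = (1 / 2 : ℝ) • ∑ j, ∑ k, curvature g φ j k i a 0 • ρ (sigma g φ k j)) ∧
    (∀ i : Fin n, ∑ j, ∑ k, pd i (christoffel g φ i j k) 0 • ρ (sigma g φ k j) = 0) ∧
    ∑ i, ∑ j, ∑ k, pd i (christoffel g φ i j k) 0 • ρ (sigma g φ k j) = 0 := by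
  have h := hφ.sum_pd_christoffel_smul_sigma ρ
  have h0 : ∀ i : Fin n, ∑ j, ∑ k, pd i (christoffel g φ i j k) 0 • ρ (sigma g φ k j) = 0 :=
    fun i => by simp [h, curvature_self]
  exact ⟨h, h0, Finset.sum_eq_zero fun i _ => h0 i⟩
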